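/- Let $m,n,k\ge 1$ be integers and let $X\in M_m\otimes M_n$, where $M_n=M_n(\mathbb{C})$, and $M_m\otimes M_n$ is identified with $M_{mn}$ (acting on $\mathbb{C}^m\otimes\mathbb{C}^n$) and carries the operator norm $\|\cdot\|$. For a linear map $\Phi:M_n\to M_k$ let $$\|\Phi\|_{cb}=\sup_{r\ge 1}\ \sup\{\|(\mathrm{id}_r\otimes\Phi)(Y)\| : Y\in M_r\otimes M_n,\ \|Y\|=1\}$$ be its completely bounded norm. The $k$-minimal operator space norm of $X$ is $$\|X\|_{MIN^k_m(M_n)}=\sup\{\|(\mathrm{id}_m\otimes\Phi)(X)\| : \Phi:M_n\to M_k \text{ linear},\ \|\Phi\|_{cb}\le 1\}.$$ The Schmidt rank $SR(v)$ of $v\in\mathbb{C}^m\otimes\mathbb{C}^n$ is the least $r$ such that $v$ is a sum of $r$ elementary tensors $a\otimes b$, and the $S(k)$-operator norm of $X$ is $$\|X\|_{S(k)}=\sup\{|\langle w|X|v\rangle| : v,w\in\mathbb{C}^m\otimes\mathbb{C}^n,\ \|v\|=\|w\|=1,\ SR(v)\le k,\ SR(w)\le k\}.$$ Then $$\|X\|_{MIN^k_m(M_n)}=\|X\|_{S(k)}.$$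 -/

import Mathlib

open scoped Kronecker

namespace OpSpace

noncomputable section

/-! The algebra `M_n` is `Matrix (Fin n) (Fin n) ℂ`, the space `ℂ^m ⊗ ℂ^n` is
`EuclideanSpace ℂ (Fin m × Fin n)`, and `M_m ⊗ M_n` is
`Matrix (Fin m × Fin n) (Fin m × Fin n) ℂ`, with `A ⊗ B` the Kronecker product. -/

/-- The complex `n × n` matrices. -/
abbrev Mat (n : ℕ) : Type := Matrix (Fin n) (Fin n) ℂ

/-- The tensor product `M_m ⊗ M_n`, identified with `M_{mn}` in the natural way. -/
abbrev BiMat (m n : ℕ) : Type := Matrix (Fin m × Fin n) (Fin m × Fin n) ℂ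

/-- The Hilbert space `ℂ^m ⊗ ℂ^n`. -/
abbrev BiVec (m n : ℕ) : Type := EuclideanSpace ℂ (Fin m × Fin n)

/-- The operator norm of a square matrix with respect to the Euclidean norm. -/
def opNorm {ι : Type} [Fintype ι] [DecidableEq ι] (X : Matrix ι ι ℂ) : ℝ :=
  ‖Matrix.toEuclideanCLM (𝕜 := ℂ) X‖

/-- The `(i, j)` block of size `n × n` of a matrix in `M_m ⊗ M_n`. -/
def block {m n : ℕ} (X : BiMat m n) (i j : Fin m) : Mat n :=
  Matrix.of fun c d => X (i, c) (j, d)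

/-- The linear map `id_m ⊗ Φ : M_m ⊗ M_n → M_m ⊗ M_k`, which applies `Φ` to each of the
`m × m` blocks of size `n × n` of a matrix. -/
def idTensor (m : ℕ) {n k : ℕ} (Φ : Mat n →ₗ[ℂ] Mat k) : BiMat m n →ₗ[ℂ] BiMat m k where
  toFun X := Matrix.of fun p q => Φ (block X p.1 q.1) p.2 q.2
  map_add' X Y := by
    ext p q
    have h : block (X + Y) p.1 q.1 = block X p.1 q.1 + block Y p.1 q.1 := rfl
    rw [Matrix.of_apply, h, map_add]
    rfl
  map_smul' t X := by
    ext p q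
    have h : block (t • X) p.1 q.1 = t • block X p.1 q.1 := rfl
    rw [Matrix.of_apply, h, map_smul]
    rfl

/-- `id_m ⊗ Φ` acts on elementary tensors as it should. -/
theorem idTensor_kronecker {m n k : ℕ} (Φ : Mat n →ₗ[ℂ] Mat k) (A : Mat m) (B : Mat n) :
    idTensor m Φ (A ⊗ₖ B) = A ⊗ₖ Φ B := by
  ext p q
  have h : block (A ⊗ₖ B) p.1 q.1 = A p.1 q.1 • B := rfl
  change Φ (block (A ⊗ₖ B) p.1 q.1) p.2 q.2 = A p.1 q.1 * Φ B p.2 q.2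
  rw [h, map_smul]
  rfl

/-- The completely bounded norm `‖Φ‖_cb = sup_{r ≥ 1} ‖id_r ⊗ Φ‖` of a linear map
`Φ : M_n → M_k`, as an element of `[0, ∞]`, where `‖Ψ‖ = sup {‖Ψ(Y)‖ : ‖Y‖ = 1}`. -/
def cbNorm {n k : ℕ} (Φ : Mat n →ₗ[ℂ] Mat k) : ENNReal :=
  ⨆ (r : ℕ) (_ : 1 ≤ r) (Y : BiMat r n) (_ : opNorm Y = 1),
    ENNReal.ofReal (opNorm (idTensor r Φ Y))

/-- The set of the values `‖(id_m ⊗ Φ)(X)‖`, for `Φ : M_n → M_k` linear and completely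
contractive. -/
def minValues (k : ℕ) {m n : ℕ} (X : BiMat m n) : Set ℝ :=
  {x | ∃ Φ : Mat n →ₗ[ℂ] Mat k, cbNorm Φ ≤ 1 ∧ x = opNorm (idTensor m Φ X)}

/-- The `k`-minimal operator space norm `‖X‖_{MIN^k_m(M_n)}` of `X ∈ M_m ⊗ M_n`. -/
def minNorm (k : ℕ) {m n : ℕ} (X : BiMat m n) : ℝ := sSup (minValues k X)

/-- The elementary tensor `a ⊗ b ∈ ℂ^m ⊗ ℂ^n`. -/
def tensorVec {m n : ℕ} (a : EuclideanSpace ℂ (Fin m)) (b : EuclideanSpace ℂ (Fin n)) :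
    BiVec m n :=
  WithLp.toLp 2 fun p => a p.1 * b p.2

/-- The vector `v` is a sum of `r` elementary tensors. -/
def IsSumOfTensors {m n : ℕ} (r : ℕ) (v : BiVec m n) : Prop :=
  ∃ (a : Fin r → EuclideanSpace ℂ (Fin m)) (b : Fin r → EuclideanSpace ℂ (Fin n)),
    v = ∑ i, tensorVec (a i) (b i)

/-- The Schmidt rank of `v ∈ ℂ^m ⊗ ℂ^n`: the least number of elementary tensors with sum `v`. -/
def schmidtRank {m n : ℕ} (v : BiVec m n) : ℕ := sInf {r | IsSumOfTensors r v}

/-- Every vector of `ℂ^m ⊗ ℂ^n` is a sum of `m` elementary tensors, so that the Schmidt rank is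
a minimum. -/
theorem isSumOfTensors_left {m n : ℕ} (v : BiVec m n) : IsSumOfTensors m v := by
  refine ⟨fun i => EuclideanSpace.single i 1, fun i => WithLp.toLp 2 fun c => v (i, c), ?_⟩
  ext p
  simp [tensorVec]

theorem isSumOfTensors_schmidtRank {m n : ℕ} (v : BiVec m n) :
    IsSumOfTensors (schmidtRank v) v :=
  Nat.sInf_mem (s := {r | IsSumOfTensors r v}) ⟨m, isSumOfTensors_left v⟩

/-- The set of the values `|⟨w|X|v⟩|`, for unit vectors `v`, `w` of Schmidt rank at most `k`. -/
def skValues (k : ℕ) {m n : ℕ} (X : BiMat m n) : Set ℝ :=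
  {x | ∃ v w : BiVec m n, ‖v‖ = 1 ∧ ‖w‖ = 1 ∧ schmidtRank v ≤ k ∧ schmidtRank w ≤ k ∧
    x = ‖inner ℂ w (Matrix.toEuclideanCLM (𝕜 := ℂ) X v)‖}

/-- The `S(k)`-operator norm `‖X‖_{S(k)}` of `X ∈ M_m ⊗ M_n`. -/
def skNorm (k : ℕ) {m n : ℕ} (X : BiMat m n) : ℝ := sSup (skValues k X)

/-! The two suprema are taken over nonempty bounded sets. -/

theorem opNorm_smul {ι : Type} [Fintype ι] [DecidableEq ι] (t : ℂ) (X : Matrix ι ι ℂ) :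
    opNorm (t • X) = ‖t‖ * opNorm X := by
  rw [opNorm, map_smul, norm_smul, opNorm]

theorem cbNorm_le_one_iff {n k : ℕ} (Φ : Mat n →ₗ[ℂ] Mat k) :
    cbNorm Φ ≤ 1 ↔
      ∀ r : ℕ, 1 ≤ r → ∀ Y : BiMat r n, opNorm (idTensor r Φ Y) ≤ opNorm Y := by
  simp only [cbNorm, iSup_le_iff, ENNReal.ofReal_le_one]
  constructor
  · intro h r hr Y
    by_cases hY : Y = 0
    · simp [hY, opNorm]
    · have h0 : 0 < opNorm Y := by simpa [opNorm] using hY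
      have h2 (Z : BiMat r k) :
          opNorm (((opNorm Y)⁻¹ : ℂ) • Z) = (opNorm Y)⁻¹ * opNorm Z := by
        rw [opNorm_smul, norm_inv, Complex.norm_real, Real.norm_of_nonneg h0.le]
      have h1 := h r hr (((opNorm Y)⁻¹ : ℂ) • Y) (by
        rw [opNorm_smul, norm_inv, Complex.norm_real, Real.norm_of_nonneg h0.le,
          inv_mul_cancel₀ h0.ne'])
      rwa [map_smul, h2, inv_mul_le_one₀ h0] at h1
  · intro h r hr Y hY
    exact hY ▸ h r hr Y

theorem minValues_nonempty (k : ℕ) {m n : ℕ} (X : BiMat m n) : (minValues k X).Nonempty := by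
  refine ⟨_, 0, (cbNorm_le_one_iff 0).2 fun r _ Y => ?_, rfl⟩
  have h : idTensor r (0 : Mat n →ₗ[ℂ] Mat k) Y = 0 := rfl
  simp [h, opNorm]

theorem minValues_bddAbove (k : ℕ) {m n : ℕ} (hm : 1 ≤ m) (X : BiMat m n) :
    BddAbove (minValues k X) := by
  refine ⟨opNorm X, ?_⟩
  rintro _ ⟨Φ, hΦ, rfl⟩
  exact (cbNorm_le_one_iff Φ).1 hΦ m hm X

theorem skValues_nonempty {k m n : ℕ} (hk : 1 ≤ k) (hm : 1 ≤ m) (hn : 1 ≤ n) (X : BiMat m n) :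
    (skValues k X).Nonempty := by
  let v : BiVec m n := EuclideanSpace.single (⟨0, hm⟩, ⟨0, hn⟩) 1
  have hv : ‖v‖ = 1 := by simp [v]
  have hr : schmidtRank v ≤ k := by
    refine le_trans (Nat.sInf_le (s := {r | IsSumOfTensors r v}) (m := 1) ?_) hk
    refine ⟨fun _ => EuclideanSpace.single ⟨0, hm⟩ 1, fun _ => EuclideanSpace.single ⟨0, hn⟩ 1, ?_⟩
    ext ⟨i, j⟩
    simp only [v, tensorVec, Prod.mk.injEq, PiLp.single_apply,
      Finset.univ_unique, Finset.sum_const, Finset.card_singleton, one_smul]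
    split_ifs <;> simp_all
  exact ⟨_, v, v, hv, hv, hr, hr, rfl⟩

theorem skValues_bddAbove (k : ℕ) {m n : ℕ} (X : BiMat m n) : BddAbove (skValues k X) := by
  refine ⟨‖Matrix.toEuclideanCLM (𝕜 := ℂ) X‖, ?_⟩
  rintro _ ⟨v, w, hv, hw, -, -, rfl⟩
  refine (norm_inner_le_norm _ _).trans ?_
  have h := (Matrix.toEuclideanCLM (𝕜 := ℂ) X).le_opNorm v
  rw [hv, mul_one] at h
  rwa [hw, one_mul]

end

end OpSpace

/-! Both inequalities come from compressing one tensor factor to dimension `k`. If `v`, `w` have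
Schmidt rank at most `k`, their second factors lie in the ranges of partial isometries `B`, `C` from
`ℂ^k`, so `⟨w|X|v⟩` is a matrix element of `(1 ⊗ C)ᴴ X (1 ⊗ B)`. This is `id_m ⊗ Φ` at `X` for the
complete contraction `Φ(Y) = Cᴴ Y B` (`idTensor_compression`). Conversely, let `Φ` map completely
contractively into `M_k`. All vectors of `ℂ^m ⊗ ℂ^k` have Schmidt rank at most `k`, so their first
factors lie in the ranges of partial isometries `U`, `V` from `ℂ^k`. Compression of the first factor
commutes with `Φ` on the second (`idTensor_conj_kronecker_one`), which leaves the norm of `(V ⊗ 1)ᴴ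
X (U ⊗ 1)`; this tests `X` only on vectors of Schmidt rank at most `k`. -/

namespace OpSpace

open Matrix
open scoped InnerProductSpace Matrix.Norms.L2Operator

/-! ### Rectangular matrices as operators, and contractions. -/

section Apply

variable {ι κ ν : Type} [Fintype κ]

/-- A rectangular matrix acting on Euclidean vectors. -/
noncomputable def apply (A : Matrix ι κ ℂ) (v : EuclideanSpace ℂ κ) : EuclideanSpace ℂ ι :=
  WithLp.toLp 2 (A *ᵥ v.ofLp)

theorem norm_apply_le [Fintype ι] [DecidableEq κ] (A : Matrix ι κ ℂ) (v : EuclideanSpace ℂ κ) :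
    ‖apply A v‖ ≤ ‖A‖ * ‖v‖ :=
  l2_opNorm_mulVec A v

theorem norm_apply_le_of_norm_le_one [Fintype ι] [DecidableEq κ] {A : Matrix ι κ ℂ} (hA : ‖A‖ ≤ 1)
    (v : EuclideanSpace ℂ κ) : ‖apply A v‖ ≤ ‖v‖ :=
  (norm_apply_le A v).trans (mul_le_of_le_one_left (norm_nonneg v) hA)

theorem apply_mul [Fintype ν] (A : Matrix ι κ ℂ) (B : Matrix κ ν ℂ) (v : EuclideanSpace ℂ ν) :
    apply (A * B) v = apply A (apply B v) := by
  simp [apply, mulVec_mulVec]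

theorem apply_sum [DecidableEq κ] {α : Type} (s : Finset α) (A : Matrix ι κ ℂ)
    (f : α → EuclideanSpace ℂ κ) :
    apply A (∑ i ∈ s, f i) = ∑ i ∈ s, apply A (f i) := by
  have h (v) : apply A v = toEuclideanLin A v := rfl
  simp only [h, map_sum]

theorem inner_apply_left [Fintype ι] (A : Matrix ι κ ℂ) (w : EuclideanSpace ℂ κ)
    (v : EuclideanSpace ℂ ι) :
    ⟪apply A w, v⟫_ℂ = ⟪w, apply Aᴴ v⟫_ℂ := by
  simp only [apply, EuclideanSpace.inner_eq_star_dotProduct, star_mulVec]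
  rw [dotProduct_comm, ← dotProduct_mulVec, dotProduct_comm]

theorem toEuclideanCLM_eq_apply [Fintype ι] [DecidableEq ι] (A : Matrix ι ι ℂ)
    (v : EuclideanSpace ℂ ι) :
    toEuclideanCLM (𝕜 := ℂ) A v = apply A v :=
  rfl

theorem norm_inner_apply_le [Fintype ι] [DecidableEq ι] (A : Matrix ι ι ℂ)
    (v w : EuclideanSpace ℂ ι) :
    ‖⟪w, apply A v⟫_ℂ‖ ≤ opNorm A * ‖v‖ * ‖w‖ := by
  rw [mul_comm _ ‖w‖]
  exact (norm_inner_le_norm _ _).trans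
    (mul_le_mul_of_nonneg_left (norm_apply_le A v) (norm_nonneg w))

theorem opNorm_nonneg [Fintype ι] [DecidableEq ι] (A : Matrix ι ι ℂ) : 0 ≤ opNorm A :=
  norm_nonneg _

theorem opNorm_le_of_norm_inner_le [Fintype ι] [DecidableEq ι] {A : Matrix ι ι ℂ} {c : ℝ}
    (hc : 0 ≤ c)
    (h : ∀ v w : EuclideanSpace ℂ ι, ‖⟪w, apply A v⟫_ℂ‖ ≤ c * ‖v‖ * ‖w‖) : opNorm A ≤ c := by
  refine ContinuousLinearMap.opNorm_le_bound _ hc fun v => ?_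
  rw [toEuclideanCLM_eq_apply]
  rcases (norm_nonneg (apply A v)).eq_or_lt with h0 | h0
  · rw [← h0]
    positivity
  -- Testing against `w = A v` gives `‖A v‖² ≤ c ‖v‖ ‖A v‖`, and one factor cancels.
  · have h1 := h v (apply A v)
    rw [inner_self_eq_norm_sq_to_K, norm_pow, pow_two] at h1
    refine le_of_mul_le_mul_right ?_ h0
    simpa using h1

theorem inner_apply_conj_mul_mul [Fintype ι] (A : Matrix ι ι ℂ) (B C : Matrix ι κ ℂ)
    (v w : EuclideanSpace ℂ κ) :
    ⟪w, apply (Cᴴ * A * B) v⟫_ℂ = ⟪apply C w, apply A (apply B v)⟫_ℂ := by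
  rw [inner_apply_left, apply_mul, apply_mul]

theorem opNorm_conj_mul_mul_le [Fintype ι] [DecidableEq ι] [DecidableEq κ] (A : Matrix ι ι ℂ)
    {B C : Matrix ι κ ℂ}
    (hB : ‖B‖ ≤ 1) (hC : ‖C‖ ≤ 1) : opNorm (Cᴴ * A * B) ≤ opNorm A := by
  refine opNorm_le_of_norm_inner_le (opNorm_nonneg A) fun v w => ?_
  rw [inner_apply_conj_mul_mul]
  refine (norm_inner_apply_le _ _ _).trans ?_
  have := opNorm_nonneg A
  gcongr
  · exact norm_apply_le_of_norm_le_one hB v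
  · exact norm_apply_le_of_norm_le_one hC w

/-- The C*-identity gives `‖A‖² = ‖Aᴴ A‖ = max ‖d i‖`. -/
theorem norm_le_one_of_conjTranspose_mul_self_eq_diagonal [Fintype ι] [DecidableEq κ]
    {A : Matrix ι κ ℂ} {d : κ → ℂ}
    (h : Aᴴ * A = diagonal d) (hd : ∀ i, ‖d i‖ ≤ 1) : ‖A‖ ≤ 1 := by
  have h1 : ‖A‖ * ‖A‖ ≤ 1 := by
    rw [← l2_opNorm_conjTranspose_mul_self, h, l2_opNorm_diagonal]
    exact (pi_norm_le_iff_of_nonneg zero_le_one).2 hd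
  nlinarith [norm_nonneg A]

theorem norm_kronecker_one_le_one [Fintype ι] [Fintype ν] [DecidableEq κ] [DecidableEq ν]
    {A : Matrix ι κ ℂ} {d : κ → ℂ}
    (h : Aᴴ * A = diagonal d) (hd : ∀ i, ‖d i‖ ≤ 1) :
    ‖A ⊗ₖ (1 : Matrix ν ν ℂ)‖ ≤ 1 := by
  refine norm_le_one_of_conjTranspose_mul_self_eq_diagonal
    (d := fun p : κ × ν => d p.1 * 1) ?_ fun p => by simpa using hd p.1
  rw [conjTranspose_kronecker, ← mul_kronecker_mul, h, conjTranspose_one, one_mul,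
    ← diagonal_one, diagonal_kronecker_diagonal]

theorem norm_one_kronecker_le_one [Fintype ι] [Fintype ν] [DecidableEq κ] [DecidableEq ν]
    {A : Matrix ι κ ℂ} {d : κ → ℂ}
    (h : Aᴴ * A = diagonal d) (hd : ∀ i, ‖d i‖ ≤ 1) :
    ‖(1 : Matrix ν ν ℂ) ⊗ₖ A‖ ≤ 1 := by
  refine norm_le_one_of_conjTranspose_mul_self_eq_diagonal
    (d := fun p : ν × κ => 1 * d p.2) ?_ fun p => by simpa using hd p.2
  rw [conjTranspose_kronecker, ← mul_kronecker_mul, h, conjTranspose_one, one_mul,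
    ← diagonal_one, diagonal_kronecker_diagonal]

end Apply

/-- Any `k` vectors lie in the range of a partial isometry with domain `ℂ^k`. -/
theorem exists_partialIsometry {m k : ℕ} (a : Fin k → EuclideanSpace ℂ (Fin m)) :
    ∃ (U : Matrix (Fin m) (Fin k) ℂ) (d : Fin k → ℂ), Uᴴ * U = diagonal d ∧
      (∀ i, ‖d i‖ ≤ 1) ∧ ∀ i, apply (U * Uᴴ) (a i) = a i := by
  -- When the `a i` are dependent (forced if `k > m`), Gram–Schmidt yields zero vectors. The
  -- matching columns of `U` vanish, so `Uᴴ U` is a 0-1 diagonal rather than the identity.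
  let u := InnerProductSpace.gramSchmidtNormed ℂ a
  let U : Matrix (Fin m) (Fin k) ℂ := of fun p i => u i p
  let d : Fin k → ℂ := fun i => if u i = 0 then 0 else 1
  have hmul (i j : Fin k) : (Uᴴ * U) i j = ⟪u i, u j⟫_ℂ := by
    simp [U, mul_apply, PiLp.inner_apply, mul_comm]
  have hUU : Uᴴ * U = diagonal d := by
    ext i j
    rw [hmul]
    by_cases hi : u i = 0
    · simp [hi, d, diagonal_apply]
    by_cases hj : u j = 0
    · have hij : i ≠ j := fun h => hi (h ▸ hj)
      simp [hj, hij]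
    · have h := orthonormal_iff_ite.1 (InnerProductSpace.gramSchmidtNormed_orthonormal' (𝕜 := ℂ) a)
        ⟨i, hi⟩ ⟨j, hj⟩
      simpa [diagonal_apply, d, hi] using h
  have hU : U * Uᴴ * U = U := by
    rw [Matrix.mul_assoc, hUU]
    ext p i
    by_cases hi : u i = 0 <;> simp [U, d, hi]
  have hcol (i : Fin k) : u i = apply U (EuclideanSpace.single i 1) := by
    ext p
    simp [apply, U]
  refine ⟨U, d, hUU, fun i => by by_cases hi : u i = 0 <;> simp [d, hi], fun i => ?_⟩
  have hmem : a i ∈ Submodule.span ℂ (Set.range u) := by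
    rw [InnerProductSpace.span_gramSchmidtNormed_range, InnerProductSpace.span_gramSchmidt]
    exact Submodule.subset_span ⟨i, rfl⟩
  -- The fixed points of `U Uᴴ` form a subspace containing the columns of `U`, which span the same
  -- space as the `a i`.
  have hle : Submodule.span ℂ (Set.range u) ≤
      LinearMap.eqLocus (toEuclideanLin (U * Uᴴ)) LinearMap.id := by
    rw [Submodule.span_le]
    rintro _ ⟨j, rfl⟩
    change apply (U * Uᴴ) (u j) = u j
    rw [hcol, ← apply_mul, hU]
  exact hle hmem

/-! ### Schmidt rank under local operators, and reduction of one factor to `ℂ^k`. -/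

section Schmidt

variable {m n k : ℕ}

theorem apply_kronecker_tensorVec {m' n' : ℕ} (A : Matrix (Fin m') (Fin m) ℂ)
    (B : Matrix (Fin n') (Fin n) ℂ) (a : EuclideanSpace ℂ (Fin m)) (b : EuclideanSpace ℂ (Fin n)) :
    apply (A ⊗ₖ B) (tensorVec a b) = tensorVec (apply A a) (apply B b) := by
  ext p
  simp only [apply, tensorVec, mulVec, dotProduct, kroneckerMap_apply, Fintype.sum_prod_type,
    Finset.sum_mul_sum]
  exact Finset.sum_congr rfl fun i _ => Finset.sum_congr rfl fun j _ => by ring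

theorem IsSumOfTensors.apply_kronecker {m' n' r : ℕ} {v : BiVec m n} (h : IsSumOfTensors r v)
    (A : Matrix (Fin m') (Fin m) ℂ) (B : Matrix (Fin n') (Fin n) ℂ) :
    IsSumOfTensors r (apply (A ⊗ₖ B) v) := by
  obtain ⟨a, b, rfl⟩ := h
  exact ⟨fun i => apply A (a i), fun i => apply B (b i), by
    simp only [apply_sum, apply_kronecker_tensorVec]⟩

theorem IsSumOfTensors.smul {r : ℕ} {v : BiVec m n} (h : IsSumOfTensors r v) (c : ℂ) :
    IsSumOfTensors r (c • v) := by
  obtain ⟨a, b, rfl⟩ := h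
  refine ⟨fun i => c • a i, b, ?_⟩
  rw [Finset.smul_sum]
  refine Finset.sum_congr rfl fun i _ => ?_
  ext p
  simp [tensorVec, mul_assoc]

theorem IsSumOfTensors.mono {r s : ℕ} {v : BiVec m n} (h : IsSumOfTensors r v) (hrs : r ≤ s) :
    IsSumOfTensors s v := by
  obtain ⟨a, b, rfl⟩ := h
  obtain ⟨t, rfl⟩ := Nat.exists_eq_add_of_le hrs
  refine ⟨Fin.append a 0, Fin.append b 0, ?_⟩
  have h0 : tensorVec (0 : EuclideanSpace ℂ (Fin m)) (0 : EuclideanSpace ℂ (Fin n)) = 0 := by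
    ext p
    simp [tensorVec]
  simp [Fin.sum_univ_add, h0]

/-- Shorter decompositions can be padded with zero tensors. -/
theorem schmidtRank_le_iff {r : ℕ} {v : BiVec m n} : schmidtRank v ≤ r ↔ IsSumOfTensors r v :=
  ⟨fun h => (isSumOfTensors_schmidtRank v).mono h,
    fun h => Nat.sInf_le (s := {r | IsSumOfTensors r v}) h⟩

theorem isSumOfTensors_right (v : BiVec m n) : IsSumOfTensors n v := by
  refine ⟨fun c => WithLp.toLp 2 fun i => v (i, c), fun c => EuclideanSpace.single c 1, ?_⟩
  ext p
  simp [tensorVec]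

/-- A vector of Schmidt rank at most `k` is supported, in the first factor, on the range of a
partial isometry with domain `ℂ^k`. -/
theorem IsSumOfTensors.exists_left {v : BiVec m n} (h : IsSumOfTensors k v) :
    ∃ U : Matrix (Fin m) (Fin k) ℂ, (∀ l : ℕ, ‖U ⊗ₖ (1 : Mat l)‖ ≤ 1) ∧
      ∃ v' : BiVec k n, ‖v'‖ ≤ ‖v‖ ∧ v = apply (U ⊗ₖ (1 : Mat n)) v' := by
  obtain ⟨a, b, rfl⟩ := h
  obtain ⟨U, d, hU, hd, ha⟩ := exists_partialIsometry a
  have h1 (l : ℕ) : ‖U ⊗ₖ (1 : Mat l)‖ ≤ 1 := norm_kronecker_one_le_one hU hd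
  -- The witness is `(U ⊗ 1)ᴴ v`: no longer than `v`, and sent back to `v` because `U Uᴴ` fixes
  -- every `a i`.
  refine ⟨U, h1, apply (U ⊗ₖ (1 : Mat n))ᴴ (∑ i, tensorVec (a i) (b i)),
    norm_apply_le_of_norm_le_one (by rw [l2_opNorm_conjTranspose]; exact h1 n) _, ?_⟩
  rw [← apply_mul, conjTranspose_kronecker, ← mul_kronecker_mul, apply_sum]
  refine Finset.sum_congr rfl fun i _ => ?_
  rw [apply_kronecker_tensorVec, ha]
  simp [apply]

/-- A vector of Schmidt rank at most `k` is supported, in the second factor, on the range of a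
partial isometry with domain `ℂ^k`. -/
theorem IsSumOfTensors.exists_right {v : BiVec m n} (h : IsSumOfTensors k v) :
    ∃ U : Matrix (Fin n) (Fin k) ℂ, (∀ l : ℕ, ‖(1 : Mat l) ⊗ₖ U‖ ≤ 1) ∧
      ∃ v' : BiVec m k, ‖v'‖ ≤ ‖v‖ ∧ v = apply ((1 : Mat m) ⊗ₖ U) v' := by
  obtain ⟨a, b, rfl⟩ := h
  obtain ⟨U, d, hU, hd, hb⟩ := exists_partialIsometry b
  have h1 (l : ℕ) : ‖(1 : Mat l) ⊗ₖ U‖ ≤ 1 := norm_one_kronecker_le_one hU hd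
  refine ⟨U, h1, apply ((1 : Mat m) ⊗ₖ U)ᴴ (∑ i, tensorVec (a i) (b i)),
    norm_apply_le_of_norm_le_one (by rw [l2_opNorm_conjTranspose]; exact h1 m) _, ?_⟩
  rw [← apply_mul, conjTranspose_kronecker, ← mul_kronecker_mul, apply_sum]
  refine Finset.sum_congr rfl fun i _ => ?_
  rw [apply_kronecker_tensorVec, hb]
  simp [apply]

end Schmidt

/-! ### The two inequalities between the norms. -/

section Norms

variable {m n k : ℕ}

theorem skNorm_nonneg (k : ℕ) (X : BiMat m n) : 0 ≤ skNorm k X := by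
  refine Real.sSup_nonneg ?_
  rintro _ ⟨v, w, -, -, -, -, rfl⟩
  exact norm_nonneg _

theorem norm_inner_apply_le_skNorm (X : BiMat m n) {v w : BiVec m n}
    (hv : IsSumOfTensors k v) (hw : IsSumOfTensors k w) :
    ‖⟪w, apply X v⟫_ℂ‖ ≤ skNorm k X * ‖v‖ * ‖w‖ := by
  by_cases hv0 : v = 0
  · simp [hv0, apply]
  by_cases hw0 : w = 0
  · simp [hw0]
  have h : ‖⟪((‖w‖⁻¹ : ℝ) : ℂ) • w,
      toEuclideanCLM (𝕜 := ℂ) X (((‖v‖⁻¹ : ℝ) : ℂ) • v)⟫_ℂ‖ ≤ skNorm k X :=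
    le_csSup (skValues_bddAbove k X) ⟨_, _, by simp [norm_smul, hv0], by simp [norm_smul, hw0],
      schmidtRank_le_iff.2 (hv.smul _), schmidtRank_le_iff.2 (hw.smul _), rfl⟩
  rw [map_smul, inner_smul_left, inner_smul_right, toEuclideanCLM_eq_apply] at h
  have hv' : 0 < ‖v‖ := norm_pos_iff.2 hv0
  have hw' : 0 < ‖w‖ := norm_pos_iff.2 hw0
  simp only [norm_mul, Complex.conj_ofReal, Complex.norm_real, norm_inv, norm_norm] at h
  rw [inv_mul_le_iff₀ hw', inv_mul_le_iff₀ hv', ← mul_assoc, mul_comm _ (skNorm k X),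
    ← mul_assoc] at h
  exact h

/-- Each block of the compressed matrix is a scalar combination of blocks of `X`, so linearity of
`Φ` suffices. -/
theorem idTensor_conj_kronecker_one {m' : ℕ} (Φ : Mat n →ₗ[ℂ] Mat k) (X : BiMat m n)
    (U V : Matrix (Fin m) (Fin m') ℂ) :
    idTensor m' Φ ((V ⊗ₖ (1 : Mat n))ᴴ * X * (U ⊗ₖ (1 : Mat n))) =
      (V ⊗ₖ (1 : Mat k))ᴴ * idTensor m Φ X * (U ⊗ₖ (1 : Mat k)) := by
  have entry {l : ℕ} (Y : BiMat m l) (p q : Fin m' × Fin l) :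
      ((V ⊗ₖ (1 : Mat l))ᴴ * Y * (U ⊗ₖ (1 : Mat l))) p q =
        ∑ j, ∑ i, star (V i p.1) * U j q.1 * Y (i, p.2) (j, q.2) := by
    simp only [mul_apply, conjTranspose_apply, kroneckerMap_apply, one_apply,
      Fintype.sum_prod_type, Finset.sum_mul]
    simp [apply_ite, mul_right_comm]
  have hblock (p q : Fin m') :
      block ((V ⊗ₖ (1 : Mat n))ᴴ * X * (U ⊗ₖ (1 : Mat n))) p q =
        ∑ j, ∑ i, (star (V i p) * U j q) • block X i j := by
    ext c d
    simp only [block, of_apply, entry, Matrix.sum_apply, Matrix.smul_apply, smul_eq_mul]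
  ext p q
  rw [entry]
  change Φ (block _ p.1 q.1) p.2 q.2 = _
  rw [hblock]
  simp only [map_sum, map_smul, Matrix.sum_apply, Matrix.smul_apply, smul_eq_mul]
  rfl

/-- The linear map `Y ↦ Cᴴ Y B`. -/
noncomputable def compression (B C : Matrix (Fin n) (Fin k) ℂ) : Mat n →ₗ[ℂ] Mat k where
  toFun Y := Cᴴ * Y * B
  map_add' Y Z := by rw [Matrix.mul_add, Matrix.add_mul]
  map_smul' t Y := by simp

theorem idTensor_compression (r : ℕ) (B C : Matrix (Fin n) (Fin k) ℂ) (Y : BiMat r n) :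
    idTensor r (compression B C) Y = ((1 : Mat r) ⊗ₖ C)ᴴ * Y * ((1 : Mat r) ⊗ₖ B) := by
  ext p q
  change (Cᴴ * block Y p.1 q.1 * B) p.2 q.2 = _
  simp only [mul_apply, conjTranspose_apply, kroneckerMap_apply, one_apply,
    Fintype.sum_prod_type, block, of_apply]
  simp [apply_ite, ite_mul, Finset.sum_ite_irrel]

theorem cbNorm_compression_le_one {B C : Matrix (Fin n) (Fin k) ℂ}
    (hB : ∀ r : ℕ, ‖(1 : Mat r) ⊗ₖ B‖ ≤ 1) (hC : ∀ r : ℕ, ‖(1 : Mat r) ⊗ₖ C‖ ≤ 1) :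
    cbNorm (compression B C) ≤ 1 := by
  refine (cbNorm_le_one_iff _).2 fun r _ Y => ?_
  rw [idTensor_compression]
  exact opNorm_conj_mul_mul_le Y (hB r) (hC r)

theorem skNorm_le_minNorm (hm : 1 ≤ m) (hn : 1 ≤ n) (hk : 1 ≤ k) (X : BiMat m n) :
    skNorm k X ≤ minNorm k X := by
  refine csSup_le (skValues_nonempty hk hm hn X) ?_
  rintro _ ⟨v, w, hv, hw, hvk, hwk, rfl⟩
  -- The two vectors need separate isometries, hence the two-sided form `Cᴴ Y B` of the compression.
  obtain ⟨B, hB, v', hv', hBv⟩ := (schmidtRank_le_iff.1 hvk).exists_right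
  obtain ⟨C, hC, w', hw', hCw⟩ := (schmidtRank_le_iff.1 hwk).exists_right
  rw [hv] at hv'
  rw [hw] at hw'
  have h : opNorm (idTensor m (compression B C) X) ≤ minNorm k X :=
    le_csSup (minValues_bddAbove k hm X) ⟨_, cbNorm_compression_le_one hB hC, rfl⟩
  refine le_trans ?_ h
  rw [toEuclideanCLM_eq_apply, hBv, hCw, ← inner_apply_conj_mul_mul, ← idTensor_compression]
  refine (norm_inner_apply_le _ _ _).trans ?_
  have h0 := opNorm_nonneg (idTensor m (compression B C) X)
  exact mul_le_of_le_one_right (by positivity) hw' |>.trans (mul_le_of_le_one_right h0 hv')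

/-- Vectors of `ℂ^k ⊗ ℂ^n` have Schmidt rank at most `k`, and local operators such as `U ⊗ 1` do not
raise it. -/
theorem opNorm_conj_kronecker_one_le_skNorm (X : BiMat m n) {U V : Matrix (Fin m) (Fin k) ℂ}
    (hU : ‖U ⊗ₖ (1 : Mat n)‖ ≤ 1) (hV : ‖V ⊗ₖ (1 : Mat n)‖ ≤ 1) :
    opNorm ((V ⊗ₖ (1 : Mat n))ᴴ * X * (U ⊗ₖ (1 : Mat n))) ≤ skNorm k X := by
  have h0 := skNorm_nonneg k X
  refine opNorm_le_of_norm_inner_le h0 fun v w => ?_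
  rw [inner_apply_conj_mul_mul]
  refine (norm_inner_apply_le_skNorm X ((isSumOfTensors_left v).apply_kronecker U 1)
    ((isSumOfTensors_left w).apply_kronecker V 1)).trans ?_
  gcongr
  · exact norm_apply_le_of_norm_le_one hU v
  · exact norm_apply_le_of_norm_le_one hV w

theorem minNorm_le_skNorm (hk : 1 ≤ k) (X : BiMat m n) : minNorm k X ≤ skNorm k X := by
  refine csSup_le (minValues_nonempty k X) ?_
  rintro _ ⟨Φ, hΦ, rfl⟩
  refine opNorm_le_of_norm_inner_le (skNorm_nonneg k X) fun v w => ?_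
  obtain ⟨U, hU, v', hv', hUv⟩ := (isSumOfTensors_right v).exists_left
  obtain ⟨V, hV, w', hw', hVw⟩ := (isSumOfTensors_right w).exists_left
  -- Complete contractivity of `Φ` is needed only at level `r = k`.
  have h : opNorm (idTensor k Φ ((V ⊗ₖ (1 : Mat n))ᴴ * X * (U ⊗ₖ (1 : Mat n)))) ≤ skNorm k X :=
    ((cbNorm_le_one_iff Φ).1 hΦ k hk _).trans
      (opNorm_conj_kronecker_one_le_skNorm X (hU n) (hV n))
  have h0 := skNorm_nonneg k X
  calc ‖⟪w, apply (idTensor m Φ X) v⟫_ℂ‖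
      = ‖⟪w', apply (idTensor k Φ ((V ⊗ₖ (1 : Mat n))ᴴ * X * (U ⊗ₖ (1 : Mat n)))) v'⟫_ℂ‖ := by
        rw [idTensor_conj_kronecker_one, inner_apply_conj_mul_mul, ← hUv, ← hVw]
    _ ≤ opNorm (idTensor k Φ ((V ⊗ₖ (1 : Mat n))ᴴ * X * (U ⊗ₖ (1 : Mat n)))) * ‖v'‖ * ‖w'‖ :=
        norm_inner_apply_le _ _ _
    _ ≤ skNorm k X * ‖v‖ * ‖w‖ := by gcongr

end Norms

end OpSpace

theorem mainTheorem1 (m n k : ℕ) (hm : 1 ≤ m) (hn : 1 ≤ n) (hk : 1 ≤ k)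
    (X : OpSpace.BiMat m n) :
    OpSpace.minNorm k X = OpSpace.skNorm k X :=
  (OpSpace.minNorm_le_skNorm hk X).antisymm (OpSpace.skNorm_le_minNorm hm hn hk X)
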